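/- Throughout, alphabets are finite and semirings need not be commutative. **Operator precedence alphabets.** An OP alphabet $(\Sigma,M)$ is an alphabet $\Sigma$ with a matrix $M$ that assigns to each ordered pair of symbols of $\Sigma\cup\{\#\}$ at most one of the relations $\lessdot,\doteq,\gtrdot$, where always $\#\lessdot a$ and $a\gtrdot\#$ for $a\in\Sigma$. For $w=a_1\cdots a_n\in\Sigma^+$ put $a_0=a_{n+1}=\#$. The chain relation on $\{0,\dots,n+1\}$ is defined inductively: $i\curvearrowright j$ if there are positions $i=k_1<\dots<k_m=j$ with $a_{k_1}\lessdot a_{k_2}\doteq\dots\doteq a_{k_{m-1}}\gtrdot a_{k_m}$ such that $k_s+1=k_{s+1}$ or $k_s\curvearrowright k_{s+1}$ for each $1\le s<m$. Let $(\Sigma,M)^+$ be the set of non-empty words $w$ over $\Sigma$ with $0\curvearrowright n+1$. A series is a map $S:(\Sigma,M)^+\to K$. **Automata.** An OPA over $(\Sigma,M)$ consists of a finite set $Q$ of states, sets $I,F\subseteq Q$ of initial and final states, and relations $\delta_{\mathrm{push}},\delta_{\mathrm{shift}}\subseteq Q\times\Sigma\times Q$ and $\delta_{\mathrm{pop}}\subseteq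 Q\times Q\times Q$. A weighted OPA (wOPA) over $(\Sigma,M)$ and a semiring $\mathbb K=(K,+,\cdot,0,1)$ has in addition weight functions $\mathrm{wt}_{op}:\delta_{op}\to K$ for $op\in\{\mathrm{push},\mathrm{shift},\mathrm{pop}\}$; it is restricted (an rwOPA) if $\mathrm{wt}_{\mathrm{pop}}\equiv 1$. Configurations are $\langle\Pi,q,x\#,k\rangle$ with a stack $\Pi\in\bot(\Sigma\times Q)^*$, a state $q$, the remaining input $x$ and $k\in K$. Let $a$ be the topmost alphabet symbol of the stack ($\#$ if the stack is $\bot$). The moves are - push: $\langle\Pi,q,bx\#,k\rangle\vdash\langle\Pi[b,q],r,x\#,k\cdot\mathrm{wt}_{\mathrm{push}}(q,b,r)\rangle$ if $a\lessdot b$ and $(q,b,r)\in\delta_{\mathrm{push}}$; - shift: $\langle\Pi[a,p],q,bx\#,k\rangle\vdash\langle\Pi[b,p],r,x\#,k\cdot\mathrm{wt}_{\mathrm{shift}}(q,b,r)\rangle$ if $a\doteq b$ and $(q,b,r)\in\delta_{\mathrm{shift}}$; - pop: $\langle\Pi[a,p],q,x\#,k\rangle\vdash\langle\Pi,r,x\#,k\cdot\mathrm{wt}_{\mathrm{pop}}(q,p,r)\rangle$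 if $a\gtrdot b$, where $b$ is the first symbol of $x\#$, and $(q,p,r)\in\delta_{\mathrm{pop}}$. An accepting run on $w$ is a sequence of moves from $\langle\bot,q_I,w\#,1\rangle$ to $\langle\bot,q_F,\#,k\rangle$ with $q_I\in I$ and $q_F\in F$; its weight is $k$. The behavior $\llbracket\mathcal A\rrbracket:(\Sigma,M)^+\to K$ maps $w$ to the sum of the weights of the (finitely many) accepting runs of $\mathcal A$ on $w$. A series is strictly regular if it is the behavior of some rwOPA over $(\Sigma,M)$ and $\mathbb K$. Moves and accepting runs of an unweighted OPA are the same without the weights; an OPL over $(\Sigma,M)$ is a set $L\subseteq(\Sigma,M)^+$ that consists of all words in $(\Sigma,M)^+$ on which some fixed OPA has an accepting run. **Projections.** For a map $h:\Sigma'\to\Sigma$ of alphabets let $h^{-1}(M)_{a'b'}=M_{h(a')h(b')}$ for $a',b'\in\Sigma'$, extend $h$ to words letter by letter, and for $T:(\Sigma',h^{-1}(M))^+\to K$ let $h(T)(v)=\sum_{w\in(\Sigma',h^{-1}(M))^+,\,h(w)=v}T(w)$ for $v\in(\Sigma,M)^+$. For $L\subseteq(\Sigma',h^{-1}(M))^+$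 let $(T\cap L)(w)=T(w)$ if $w\in L$ and $(T\cap L)(w)=0$ otherwise. **Theorem.** Let $(\Sigma,M)$ be an OP alphabet, $\mathbb K$ a semiring and $S:(\Sigma,M)^+\to K$ a series. Then $S$ is strictly regular if and only if there exist an alphabet $\Sigma'$, a map $h:\Sigma'\to\Sigma$, an rwOPA $\mathcal B$ with exactly one state over $(\Sigma',h^{-1}(M))$ and $\mathbb K$, and an OPL $L$ over $(\Sigma',h^{-1}(M))$ such that $S=h(\llbracket\mathcal B\rrbracket\cap L)$. -/

import Mathlib

/-- The three operator precedence relations: `yields` is `⋖`, `equal` is `≐`, `takes` is `⋗`. -/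
inductive Prec where
  | yields
  | equal
  | takes

/-- An operator precedence matrix over the alphabet `α`: every ordered pair of letters is in at
most one precedence relation (`none` is an empty entry). The entries for the delimiter `#`, which
are the same for every matrix, are added in `OPM.prec`. -/
structure OPM (α : Type*) where
  entry : α → α → Option Prec

namespace OPM

variable {α β : Type*}

/-- The matrix on `α ∪ {#}`, with `none : Option α` for `#`: always `# ⋖ a` and `a ⋗ #`.
(No notion below ever consults the entry at `(#, #)`.) -/
def prec (M : OPM α) : Option α → Option α → Option Prec
  | some a, some b => M.entry a b
  | none, some _ => some Prec.yields
  | some _, none => some Prec.takes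
  | none, none => none

/-- The inverse image `h⁻¹(M)` of an operator precedence matrix under a map of alphabets. -/
def comap (h : β → α) (M : OPM α) : OPM β where
  entry a b := M.entry (h a) (h b)

/-- The symbol at position `i` of `#w#`; `w = a₁ ⋯ aₙ` occupies the positions `1, …, n`, and the
positions `0` and `n + 1` carry `#`. -/
def symbolAt (w : List α) : ℕ → Option α
  | 0 => none
  | i + 1 => w[i]?

/-- The chain relation `i ↷ j` on the positions `0, …, n + 1` of `#w#`: there are positions
`i = k 1 < k 2 < ⋯ < k m = j` with `a_{k 1} ⋖ a_{k 2} ≐ ⋯ ≐ a_{k (m-1)} ⋗ a_{k m}` such that any two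
consecutive ones are adjacent or in the chain relation. (The values of `k` outside `1, …, m` play
no role.) -/
inductive ChainRel (M : OPM α) (w : List α) : ℕ → ℕ → Prop
  | intro (i j m : ℕ) (k : ℕ → ℕ) (three_le : 3 ≤ m)
      (first : k 1 = i) (last : k m = j) (bound : j ≤ w.length + 1)
      (increasing : ∀ s, 1 ≤ s → s < m → k s < k (s + 1))
      (yields : M.prec (symbolAt w (k 1)) (symbolAt w (k 2)) = some Prec.yields)
      (equal : ∀ s, 2 ≤ s → s + 1 < m →
        M.prec (symbolAt w (k s)) (symbolAt w (k (s + 1))) = some Prec.equal)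
      (takes : M.prec (symbolAt w (k (m - 1))) (symbolAt w (k m)) = some Prec.takes)
      (link : ∀ s, 1 ≤ s → s < m → k s + 1 ≠ k (s + 1) → ChainRel M w (k s) (k (s + 1))) :
      ChainRel M w i j

/-- `w` is compatible with `M` if `0 ↷ n + 1` holds in `#w#`. -/
def Compatible (M : OPM α) (w : List α) : Prop :=
  M.ChainRel w 0 (w.length + 1)

end OPM

/-- `(Σ, M)⁺`: the non-empty words that are compatible with `M`. -/
abbrev OPWord {α : Type*} (M : OPM α) : Type _ :=
  {w : List α // w ≠ [] ∧ M.Compatible w}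

/-- OP-series `S : (Σ, M)⁺ → K`. -/
abbrev OPSeries {α : Type*} (M : OPM α) (K : Type*) : Type _ :=
  OPWord M → K

/-- A nondeterministic operator precedence automaton over `(α, M)` with state set `Q`. (Finiteness
of `Q` is demanded where automata are quantified over.) -/
structure OPA {α : Type*} (M : OPM α) (Q : Type*) where
  init : Set Q
  final : Set Q
  push : Set (Q × α × Q)
  shift : Set (Q × α × Q)
  pop : Set (Q × Q × Q)

/-- The topmost alphabet symbol of a stack, whose top is the head of the list; it is `#` (that is,
`none`) for the empty stack `⊥`. -/
def topSymbol {α Q : Type*} (st : List (α × Q)) : Option α :=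
  st.head?.map Prod.fst

namespace OPA

variable {α Q : Type*} {M : OPM α}

/-- Configurations `⟨Π, q, x#⟩`; only `x` is stored, so the next input symbol is `x.head?`, with
`none` for `#`. -/
structure Config (α Q : Type*) where
  stack : List (α × Q)
  state : Q
  input : List α

/-- The moves `C ⊢ C'` of an operator precedence automaton. -/
inductive Step (A : OPA M Q) : Config α Q → Config α Q → Prop
  | push (st : List (α × Q)) (q r : Q) (b : α) (x : List α)
      (hM : M.prec (topSymbol st) (some b) = some Prec.yields) (hA : (q, b, r) ∈ A.push) :
      Step A ⟨st, q, b :: x⟩ ⟨(b, q) :: st, r, x⟩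
  | shift (st : List (α × Q)) (a : α) (p q r : Q) (b : α) (x : List α)
      (hM : M.prec (some a) (some b) = some Prec.equal) (hA : (q, b, r) ∈ A.shift) :
      Step A ⟨(a, p) :: st, q, b :: x⟩ ⟨(b, p) :: st, r, x⟩
  | pop (st : List (α × Q)) (a : α) (p q r : Q) (x : List α)
      (hM : M.prec (some a) x.head? = some Prec.takes) (hA : (q, p, r) ∈ A.pop) :
      Step A ⟨(a, p) :: st, q, x⟩ ⟨st, r, x⟩

/-- The language of an operator precedence automaton: the words in `(Σ, M)⁺` on which there is a
finite sequence of moves from `⟨⊥, q_I, w#⟩` to `⟨⊥, q_F, #⟩`, `q_I` initial and `q_F` final. -/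
def language (A : OPA M Q) : Set (OPWord M) :=
  {w | ∃ qI ∈ A.init, ∃ qF ∈ A.final,
    Relation.ReflTransGen A.Step ⟨[], qI, w.1⟩ ⟨[], qF, []⟩}

end OPA

/-- `L ⊆ (Σ, M)⁺` is an operator precedence language (OPL) if some OPA accepts it. -/
def IsOPL {α : Type*} {M : OPM α} (L : Set (OPWord M)) : Prop :=
  ∃ (Q : Type) (_ : Finite Q) (A : OPA M Q), A.language = L

/-- A weighted operator precedence automaton over `(α, M)` and `K` with state set `Q`. The weight
functions matter only at the transitions of the automaton. -/
structure WOPA {α : Type*} (M : OPM α) (K : Type*) (Q : Type*) extends OPA M Q where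
  wtPush : Q → α → Q → K
  wtShift : Q → α → Q → K
  wtPop : Q → Q → Q → K

namespace WOPA

variable {α K Q : Type*} {M : OPM α}

/-- A weighted automaton is restricted (an rwOPA) if all its pop transitions have weight `1`. -/
def Restricted [One K] (A : WOPA M K Q) : Prop :=
  ∀ q p r, (q, p, r) ∈ A.pop → A.wtPop q p r = 1

/-- Weighted configurations `⟨Π, q, x#, k⟩`. -/
structure Config (α Q K : Type*) where
  stack : List (α × Q)
  state : Q
  input : List α
  weight : K

/-- The moves of a weighted operator precedence automaton. -/
inductive Step [Mul K] (A : WOPA M K Q) : Config α Q K → Config α Q K → Prop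
  | push (st : List (α × Q)) (q r : Q) (b : α) (x : List α) (k : K)
      (hM : M.prec (topSymbol st) (some b) = some Prec.yields) (hA : (q, b, r) ∈ A.push) :
      Step A ⟨st, q, b :: x, k⟩ ⟨(b, q) :: st, r, x, k * A.wtPush q b r⟩
  | shift (st : List (α × Q)) (a : α) (p q r : Q) (b : α) (x : List α) (k : K)
      (hM : M.prec (some a) (some b) = some Prec.equal) (hA : (q, b, r) ∈ A.shift) :
      Step A ⟨(a, p) :: st, q, b :: x, k⟩ ⟨(b, p) :: st, r, x, k * A.wtShift q b r⟩
  | pop (st : List (α × Q)) (a : α) (p q r : Q) (x : List α) (k : K)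
      (hM : M.prec (some a) x.head? = some Prec.takes) (hA : (q, p, r) ∈ A.pop) :
      Step A ⟨(a, p) :: st, q, x, k⟩ ⟨st, r, x, k * A.wtPop q p r⟩

variable [Semiring K]

/-- The accepting runs on `w`: sequences of configurations, each obtained from the preceding one
by a move, that lead from `⟨⊥, q_I, w#, 1⟩` to some `⟨⊥, q_F, #, k⟩`, `q_I` initial, `q_F` final. -/
def acceptingRuns (A : WOPA M K Q) (w : List α) : Set (List (Config α Q K)) :=
  {ρ | ρ.IsChain A.Step ∧ (∃ qI ∈ A.init, ρ.head? = some ⟨[], qI, w, 1⟩) ∧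
    ∃ qF ∈ A.final, ∃ k, ρ.getLast? = some ⟨[], qF, [], k⟩}

/-- The weight of a run: the weight component of its last configuration. -/
def runWeight (ρ : List (Config α Q K)) : K :=
  ρ.getLast?.elim 0 Config.weight

/-- The behavior of a weighted operator precedence automaton: the sum of the weights of the
accepting runs, which are finitely many by `finite_acceptingRuns`. -/
noncomputable def behavior (A : WOPA M K Q) : OPSeries M K :=
  fun w => ∑ᶠ ρ ∈ A.acceptingRuns w.1, runWeight ρ

theorem finite_setOf_step [Finite Q] (A : WOPA M K Q) (C : Config α Q K) :
    {D | A.Step C D}.Finite := by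
  obtain ⟨st, q, x, k⟩ := C
  have h1 : (Set.range fun r : Q => (⟨(x.head?.elim [] fun b => [(b, q)]) ++ st, r, x.tail,
      k * (x.head?.elim 1 fun b => A.wtPush q b r)⟩ : Config α Q K)).Finite := Set.finite_range _
  have h2 : (Set.range fun r : Q => (⟨(x.head?.elim [] fun b =>
      st.head?.elim [] fun ap => [(b, ap.2)]) ++ st.tail, r, x.tail,
      k * (x.head?.elim 1 fun b => A.wtShift q b r)⟩ : Config α Q K)).Finite := Set.finite_range _
  have h3 : (Set.range fun r : Q => (⟨st.tail, r, x,
      k * (st.head?.elim 1 fun ap => A.wtPop q ap.2 r)⟩ : Config α Q K)).Finite :=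
    Set.finite_range _
  refine ((h1.union h2).union h3).subset ?_
  intro D hD
  cases hD with
  | push => exact Or.inl (Or.inl ⟨_, rfl⟩)
  | shift => exact Or.inl (Or.inr ⟨_, rfl⟩)
  | pop => exact Or.inr ⟨_, rfl⟩

theorem finite_setOf_isChain [Finite Q] (A : WOPA M K Q) (n : ℕ) :
    ∀ C : Config α Q K, 2 * C.input.length + C.stack.length ≤ n →
      {ρ | (C :: ρ).IsChain A.Step}.Finite := by
  induction n with
  | zero =>
    intro C hC
    refine (Set.finite_singleton []).subset ?_
    rintro (_ | ⟨D, ρ⟩) hρ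
    · rfl
    · have h := (List.isChain_cons_cons.1 hρ).1
      cases h <;> simp at hC
  | succ n ih =>
    intro C hC
    have hfin : (⋃ D ∈ {D | A.Step C D},
        List.cons D '' {ρ | (D :: ρ).IsChain A.Step}).Finite := by
      refine (A.finite_setOf_step C).biUnion fun D hD => Set.Finite.image _ (ih D ?_)
      have hD' : A.Step C D := hD
      cases hD' <;> simp at hC ⊢ <;> omega
    refine ((Set.finite_singleton []).union hfin).subset ?_
    rintro (_ | ⟨D, ρ⟩) hρ
    · exact Or.inl rfl
    · have h := List.isChain_cons_cons.1 hρ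
      exact Or.inr (Set.mem_biUnion (show D ∈ {D | A.Step C D} from h.1) ⟨ρ, h.2, rfl⟩)

theorem finite_acceptingRuns [Finite Q] (A : WOPA M K Q) (w : List α) :
    (A.acceptingRuns w).Finite := by
  have hfin : (⋃ q : Q, List.cons (⟨[], q, w, 1⟩ : Config α Q K) ''
      {ρ | ((⟨[], q, w, 1⟩ : Config α Q K) :: ρ).IsChain A.Step}).Finite :=
    Set.finite_iUnion fun q => Set.Finite.image _ (A.finite_setOf_isChain _ _ le_rfl)
  refine hfin.subset ?_
  rintro (_ | ⟨D, ρ⟩) ⟨hρ, ⟨q, -, hq⟩, -⟩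
  · simp at hq
  · simp only [List.head?_cons, Option.some.injEq] at hq
    subst hq
    exact Set.mem_iUnion.2 ⟨q, ρ, hρ, rfl⟩

end WOPA

/-- A series is strictly regular if it is the behavior of some restricted weighted OPA. -/
def IsStrictlyRegular {α K : Type*} [Semiring K] {M : OPM α} (S : OPSeries M K) : Prop :=
  ∃ (Q : Type) (_ : Finite Q) (A : WOPA M K Q), A.Restricted ∧ A.behavior = S

/-- The image `h(S) : (Σ, M)⁺ → K` of a series `S : (Σ', h⁻¹(M))⁺ → K` under `h : Σ' → Σ`: the sum
of `S` over all preimages, which are finitely many for a finite alphabet `Σ'` by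
`finite_setOf_map_eq`. -/
noncomputable def imageSeries {α β K : Type*} [Semiring K] {M : OPM α} (h : β → α)
    (S : OPSeries (M.comap h) K) : OPSeries M K :=
  fun v => ∑ᶠ w ∈ {w : OPWord (M.comap h) | w.1.map h = v.1}, S w

theorem finite_setOf_map_eq {α β : Type*} [Finite β] {M : OPM α} (h : β → α) (v : OPWord M) :
    {w : OPWord (M.comap h) | w.1.map h = v.1}.Finite := by
  refine Set.Finite.of_finite_image (f := Subtype.val) ?_ Subtype.val_injective.injOn
  refine (List.finite_length_eq β v.1.length).subset ?_
  rintro _ ⟨w, hw, rfl⟩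
  have hw' : w.1.map h = v.1 := hw
  simp [← hw']

/-- The class `𝒩(Σ, M, K)`: the series `h(⟦B⟧ ∩ L)` for an alphabet `Σ'`, a map `h : Σ' → Σ`, a
restricted weighted OPA `B` over `(Σ', h⁻¹(M))` with exactly one state, and an OPL `L` over
`(Σ', h⁻¹(M))`. Here `⟦B⟧ ∩ L` agrees with `⟦B⟧` on `L` and is `0` elsewhere. -/
def NivatClass {α : Type*} (M : OPM α) (K : Type*) [Semiring K] : Set (OPSeries M K) :=
  {S | ∃ (β : Type) (_ : Finite β) (h : β → α) (Q : Type) (_ : Nat.card Q = 1)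
    (B : WOPA (M.comap h) K Q) (L : Set (OPWord (M.comap h))),
    B.Restricted ∧ IsOPL L ∧ S = imageSeries h (L.indicator B.behavior)}

/-! The kind of a move depends only on precedence relations, which relabelling by `h` preserves.
Hence automata over `Σ` and `Σ'` move in lockstep on `v` and on any `w` with `h(w) = v`, and both
directions are inductions along these common moves (`OPM.move_induction`). `WOPA.totalWeight` is the
weight still to be collected, `liftSum` sums over the fibre of `v` letter by letter; since both are
nested from left to right, no commutativity is needed.

From an rwOPA to a projection: let `Σ'` spell out transitions. Pushes and shifts consume a letter
and can be written on it; a pop consumes none, but it removes an entry created by exactly one push,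
so its target can be promised on that push letter. An OPL checks that the annotations describe an
accepting run. Pops have weight 1, so the weight of a run is a product of letter weights, for which
one state suffices. In mid-run the promises of the entries on the stack are still open;
`WOPA.totalWeight_eq_liftSum_runChecker` therefore sums over them too.

Conversely, a nondeterministic automaton for `L` would count a word once per accepting run, so it is
determinized. A subset consists of pairs (current state, state in the topmost stack entry): the
second component tells a pop how to connect with the subset stored below. Letters of `Σ'` with the
same image and the same successor subset are merged by adding their weights, and distributivity
gives `WOPA.totalWeight_subsetImage`. -/

/-! ### Sums over the preimages of a word -/

open scoped Classical in
/-- The sum of `f w` over all words `w` with `w.map g = l`. -/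
noncomputable def liftSum {γ δ K : Type*} [Fintype γ] [Semiring K] (g : γ → δ) :
    List δ → (List γ → K) → K
  | [], f => f []
  | d :: l, f => ∑ c with g c = d, liftSum g l fun w => f (c :: w)

section liftSum

variable {γ δ K : Type*} [Fintype γ] [Semiring K] (g : γ → δ)

theorem liftSum_congr {l : List δ} {f f' : List γ → K}
    (hf : ∀ w, w.map g = l → f w = f' w) : liftSum g l f = liftSum g l f' := by
  classical
  induction l generalizing f f' with
  | nil => exact hf [] rfl
  | cons d l ih =>
    refine Finset.sum_congr rfl fun c hc => ih fun w hw => hf _ ?_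
    simp [(Finset.mem_filter.1 hc).2, hw]

theorem liftSum_zero (l : List δ) : liftSum g l (fun _ => (0 : K)) = 0 := by
  induction l with
  | nil => rfl
  | cons d l ih => exact Finset.sum_eq_zero fun c _ => ih

theorem liftSum_mul_left (l : List δ) (k : K) (f : List γ → K) :
    liftSum g l (fun w => k * f w) = k * liftSum g l f := by
  induction l generalizing f with
  | nil => rfl
  | cons d l ih => simp only [liftSum, ih, Finset.mul_sum]

theorem liftSum_sum {ι : Type*} (s : Finset ι) (l : List δ) (f : ι → List γ → K) :
    liftSum g l (fun w => ∑ i ∈ s, f i w) = ∑ i ∈ s, liftSum g l (f i) := by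
  induction l generalizing f with
  | nil => rfl
  | cons d l ih =>
    simp only [liftSum, ih]
    exact Finset.sum_comm

/-- The fibre over `d :: l` is partitioned by the first letter. -/
theorem finsum_mem_map_eq (l : List δ) (f : List γ → K) :
    ∑ᶠ w ∈ {w : List γ | w.map g = l}, f w = liftSum g l f := by
  classical
  have hfin : ∀ l : List δ, {w : List γ | w.map g = l}.Finite := fun l =>
    (List.finite_length_eq γ l.length).subset fun w hw => by
      have hw' : w.map g = l := hw
      simp [← hw']
  induction l generalizing f with
  | nil => simp [liftSum]
  | cons d l ih =>
    have hset : {w : List γ | w.map g = d :: l} =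
        ⋃ c ∈ {c | g c = d}, List.cons c '' {w | w.map g = l} := by
      ext w
      cases w <;> simp [and_comm]
    rw [hset, finsum_mem_biUnion _ (Set.toFinite _) fun c _ => (hfin l).image _]
    · rw [finsum_mem_eq_sum_of_inter_support_eq (t := Finset.univ.filter fun c => g c = d) _
        (by ext; simp)]
      refine Finset.sum_congr rfl fun c _ => ?_
      rw [finsum_mem_image (List.cons_injective.injOn), ih]
    · intro c _ c' _ hne
      refine Set.disjoint_left.2 ?_
      rintro _ ⟨w, _, rfl⟩ ⟨w', _, h⟩
      simp only [List.cons.injEq] at h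
      exact hne h.1.symm

end liftSum

/-! ### Relabelling of chains, and induction along moves -/

namespace OPM

variable {α β : Type*}

theorem prec_comap (h : β → α) (M : OPM α) (a b : Option β) :
    (M.comap h).prec a b = M.prec (a.map h) (b.map h) := by
  cases a <;> cases b <;> rfl

theorem symbolAt_map (h : β → α) (w : List β) (i : ℕ) :
    symbolAt (w.map h) i = (symbolAt w i).map h := by
  cases i <;> simp [symbolAt]

/-- Chains see letters only through precedence relations. Consequently every preimage of a
compatible word is compatible, and `imageSeries_eq_liftSum` can sum over all words in the fibre. -/
theorem chainRel_comap (h : β → α) (M : OPM α) (w : List β) (i j : ℕ) :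
    (M.comap h).ChainRel w i j ↔ M.ChainRel (w.map h) i j := by
  constructor
  · intro H
    induction H with
    | intro i j m k h3 h1 hm hb hi hy he ht _ ih =>
      simp only [prec_comap, ← symbolAt_map] at hy he ht
      exact .intro i j m k h3 h1 hm (by simpa using hb) hi hy he ht ih
  · intro H
    induction H with
    | intro i j m k h3 h1 hm hb hi hy he ht _ ih =>
      simp only [symbolAt_map, ← prec_comap] at hy he ht
      exact .intro i j m k h3 h1 hm (by simpa using hb) hi hy he ht ih

theorem compatible_comap (h : β → α) (M : OPM α) (w : List β) :
    (M.comap h).Compatible w ↔ M.Compatible (w.map h) := by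
  simp [Compatible, chainRel_comap]

end OPM

theorem imageSeries_eq_liftSum {α β K : Type*} [Fintype β] [Semiring K] {M : OPM α} (h : β → α)
    (T : OPSeries (M.comap h) K) (f : List β → K) (hf : ∀ w : OPWord (M.comap h), T w = f w.1)
    (v : OPWord M) : imageSeries h T v = liftSum h v.1 f := by
  have hset : {w : List β | w.map h = v.1} =
      Subtype.val '' {w : OPWord (M.comap h) | w.1.map h = v.1} := by
    ext w
    constructor
    · intro hw
      have hw' : w.map h = v.1 := hw
      refine ⟨⟨w, ?_, ?_⟩, hw, rfl⟩
      · rintro rfl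
        exact v.2.1 hw'.symm
      · rw [OPM.compatible_comap, hw']
        exact v.2.2
    · rintro ⟨w, hw, rfl⟩
      exact hw
  rw [← finsum_mem_map_eq, hset, finsum_mem_image Subtype.val_injective.injOn]
  simp only [imageSeries, hf]

theorem topSymbol_map {α β Q R : Type*} (h : β → α) (g : Q → R) (st : List (β × Q)) :
    topSymbol (st.map (Prod.map h g)) = (topSymbol st).map h := by
  cases st <;> rfl

/-- Induction along the moves, whose kinds are determined by the stack symbols and the input. -/
theorem OPM.move_induction {α β Q : Type*} (M : OPM α) (h : β → α)
    {motive : List (α × Q) → List β → Prop}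
    (nil : motive [] [])
    (push : ∀ st b x, M.prec (topSymbol st) (some (h b)) = some Prec.yields →
      (∀ q, motive ((h b, q) :: st) x) → motive st (b :: x))
    (shift : ∀ st a p b x, M.prec (some a) (some (h b)) = some Prec.equal →
      motive ((h b, p) :: st) x → motive ((a, p) :: st) (b :: x))
    (pop : ∀ st a p x, M.prec (some a) (x.head?.map h) = some Prec.takes →
      motive st x → motive ((a, p) :: st) x)
    (stuck : ∀ st b x, M.prec (topSymbol st) (some (h b)) = none → motive st (b :: x))
    (st : List (α × Q)) (x : List β) : motive st x := by
  -- A push trades an input letter for a stack entry, so letters count twice.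
  induction hn : 2 * x.length + st.length using Nat.strong_induction_on generalizing st x with
  | _ n ih =>
    subst hn
    match st, x with
    | [], [] => exact nil
    | (a, p) :: st, [] => exact pop _ _ _ _ rfl (ih _ (by simp) _ _ rfl)
    | [], b :: x => exact push _ _ _ rfl fun q => ih _ (by simp; omega) _ _ rfl
    | (a, p) :: st, b :: x =>
      match hM : M.prec (some a) (some (h b)) with
      | none => exact stuck _ _ _ hM
      | some .yields => exact push _ _ _ hM fun q => ih _ (by simp; omega) _ _ rfl
      | some .equal => exact shift _ _ _ _ _ hM (ih _ (by simp) _ _ rfl)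
      | some .takes => exact pop _ _ _ _ hM (ih _ (by simp) _ _ rfl)

/-! ### Acceptance in terms of the images of stack symbols -/

namespace OPA

variable {α β Q : Type*} {M : OPM α} {h : β → α}

/-- `A.Accepts st q x`: some run leads from state `q`, input `x` and a stack with states and images
of symbols under `h` as in `st` to acceptance. -/
inductive Accepts (A : OPA (M.comap h) Q) : List (α × Q) → Q → List β → Prop
  | nil (q : Q) (hq : q ∈ A.final) : Accepts A [] q []
  | push (st : List (α × Q)) (q r : Q) (b : β) (x : List β)
      (hM : M.prec (topSymbol st) (some (h b)) = some Prec.yields) (hA : (q, b, r) ∈ A.push)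
      (H : Accepts A ((h b, q) :: st) r x) : Accepts A st q (b :: x)
  | shift (st : List (α × Q)) (a : α) (p q r : Q) (b : β) (x : List β)
      (hM : M.prec (some a) (some (h b)) = some Prec.equal) (hA : (q, b, r) ∈ A.shift)
      (H : Accepts A ((h b, p) :: st) r x) : Accepts A ((a, p) :: st) q (b :: x)
  | pop (st : List (α × Q)) (a : α) (p q r : Q) (x : List β)
      (hM : M.prec (some a) (x.head?.map h) = some Prec.takes) (hA : (q, p, r) ∈ A.pop)
      (H : Accepts A st r x) : Accepts A ((a, p) :: st) q x

variable {A : OPA (M.comap h) Q}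

theorem accepts_nil_iff {q : Q} : A.Accepts [] q [] ↔ q ∈ A.final := by
  constructor
  · intro H
    cases H with
    | nil _ hq => exact hq
  · exact .nil q

/-- A pair of symbols is in at most one relation, so the other two kinds of move are excluded. -/
theorem accepts_push_iff {st : List (α × Q)} {q : Q} {b : β} {x : List β}
    (hM : M.prec (topSymbol st) (some (h b)) = some Prec.yields) :
    A.Accepts st q (b :: x) ↔ ∃ r, (q, b, r) ∈ A.push ∧ A.Accepts ((h b, q) :: st) r x := by
  constructor
  · intro H
    cases H with
    | push _ _ r _ _ _ hA H => exact ⟨r, hA, H⟩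
    | shift _ _ _ _ _ _ _ hM' => simp [topSymbol, hM'] at hM
    | pop _ _ _ _ _ _ hM' => simp [topSymbol] at hM hM'; simp [hM'] at hM
  · rintro ⟨r, hA, H⟩
    exact .push _ _ _ _ _ hM hA H

theorem accepts_shift_iff {st : List (α × Q)} {a : α} {p q : Q} {b : β} {x : List β}
    (hM : M.prec (some a) (some (h b)) = some Prec.equal) :
    A.Accepts ((a, p) :: st) q (b :: x) ↔
      ∃ r, (q, b, r) ∈ A.shift ∧ A.Accepts ((h b, p) :: st) r x := by
  constructor
  · intro H
    cases H with
    | push _ _ _ _ _ hM' => simp [topSymbol, hM] at hM'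
    | shift _ _ _ _ r _ _ _ hA H => exact ⟨r, hA, H⟩
    | pop _ _ _ _ _ _ hM' => simp at hM hM'; simp [hM'] at hM
  · rintro ⟨r, hA, H⟩
    exact .shift _ _ _ _ _ _ _ hM hA H

theorem accepts_pop_iff {st : List (α × Q)} {a : α} {p q : Q} {x : List β}
    (hM : M.prec (some a) (x.head?.map h) = some Prec.takes) :
    A.Accepts ((a, p) :: st) q x ↔ ∃ r, (q, p, r) ∈ A.pop ∧ A.Accepts st r x := by
  constructor
  · intro H
    cases H with
    | push _ _ _ _ _ hM' => simp [topSymbol] at hM hM'; simp [hM'] at hM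
    | shift _ _ _ _ _ _ _ hM' => simp at hM hM'; simp [hM'] at hM
    | pop _ _ _ _ r _ _ hA H => exact ⟨r, hA, H⟩
  · rintro ⟨r, hA, H⟩
    exact .pop _ _ _ _ _ _ hM hA H

theorem not_accepts_of_prec_eq_none {st : List (α × Q)} {q : Q} {b : β} {x : List β}
    (hM : M.prec (topSymbol st) (some (h b)) = none) : ¬ A.Accepts st q (b :: x) := by
  intro H
  cases H with
  | push _ _ _ _ _ hM' => simp [hM'] at hM
  | shift _ _ _ _ _ _ _ hM' => simp [topSymbol, hM'] at hM
  | pop _ _ _ _ _ _ hM' => simp [topSymbol] at hM hM'; simp [hM'] at hM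

theorem accepts_of_reflTransGen {c d : Config β Q} (H : Relation.ReflTransGen A.Step c d)
    (h1 : d.stack = []) (h2 : d.state ∈ A.final) (h3 : d.input = []) :
    A.Accepts (c.stack.map (Prod.map h id)) c.state c.input := by
  induction H using Relation.ReflTransGen.head_induction_on with
  | refl =>
    rw [h1, h3]
    exact .nil _ h2
  | head hstep _ ih =>
    cases hstep with
    | push st q r b x hM hA =>
      rw [OPM.prec_comap, ← topSymbol_map h id] at hM
      exact .push _ _ _ _ _ hM hA ih
    | shift st a p q r b x hM hA => exact .shift _ _ _ _ _ _ _ hM hA ih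
    | pop st a p q r x hM hA =>
      rw [OPM.prec_comap] at hM
      exact .pop _ _ _ _ _ _ hM hA ih

theorem exists_reflTransGen_of_accepts {st' : List (α × Q)} {q : Q} {x : List β}
    (H : A.Accepts st' q x) (st : List (β × Q)) (hst : st.map (Prod.map h id) = st') :
    ∃ qF ∈ A.final, Relation.ReflTransGen A.Step ⟨st, q, x⟩ ⟨[], qF, []⟩ := by
  induction H generalizing st with
  | nil q hq =>
    obtain rfl : st = [] := by simpa using hst
    exact ⟨q, hq, .refl⟩
  | push st' q r b x hM hA _ ih =>
    obtain ⟨qF, hF, hr⟩ := ih ((b, q) :: st) (by simp [hst])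
    refine ⟨qF, hF, .head (.push _ _ _ _ _ ?_ hA) hr⟩
    rw [OPM.prec_comap, ← topSymbol_map h id, hst]
    exact hM
  | shift st' a p q r b x hM hA _ ih =>
    obtain ⟨⟨a, p⟩, st, rfl, hap, rfl⟩ := List.map_eq_cons_iff.1 hst
    obtain ⟨rfl, rfl⟩ := Prod.mk.inj hap
    obtain ⟨qF, hF, hr⟩ := ih ((b, p) :: st) rfl
    exact ⟨qF, hF, .head (.shift _ _ _ _ _ _ _ hM hA) hr⟩
  | pop st' a p q r x hM hA _ ih =>
    obtain ⟨⟨a, p⟩, st, rfl, hap, rfl⟩ := List.map_eq_cons_iff.1 hst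
    obtain ⟨rfl, rfl⟩ := Prod.mk.inj hap
    obtain ⟨qF, hF, hr⟩ := ih st rfl
    refine ⟨qF, hF, .head (.pop _ _ _ _ _ _ ?_ hA) hr⟩
    rw [OPM.prec_comap]
    exact hM

theorem mem_language_iff (A : OPA (M.comap h) Q) (w : OPWord (M.comap h)) :
    w ∈ A.language ↔ ∃ q ∈ A.init, A.Accepts [] q w.1 := by
  constructor
  · rintro ⟨q, hq, qF, hF, H⟩
    exact ⟨q, hq, accepts_of_reflTransGen H rfl hF rfl⟩
  · rintro ⟨q, hq, H⟩
    obtain ⟨qF, hF, H⟩ := exists_reflTransGen_of_accepts H [] rfl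
    exact ⟨q, hq, qF, hF, H⟩

end OPA

/-! ### The behavior as a recursively computed weight -/

namespace WOPA

variable {α β K Q : Type*} {M : OPM α} {h : β → α} [Semiring K] [Fintype Q]

open scoped Classical in
/-- The sum of the weights of the runs that lead from state `q`, input `x` and a stack with states
and images of symbols under `h` as in `st` to acceptance. -/
noncomputable def totalWeight (A : WOPA (M.comap h) K Q) : List (α × Q) → Q → List β → K
  | [], q, [] => if q ∈ A.final then 1 else 0
  | (_, p) :: st, q, [] =>
    ∑ r, if (q, p, r) ∈ A.pop then A.wtPop q p r * totalWeight A st r [] else 0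
  | [], q, b :: x =>
    ∑ r, if (q, b, r) ∈ A.push then A.wtPush q b r * totalWeight A [(h b, q)] r x else 0
  | (a, p) :: st, q, b :: x =>
    match M.entry a (h b) with
    | some .yields => ∑ r, if (q, b, r) ∈ A.push then
        A.wtPush q b r * totalWeight A ((h b, q) :: (a, p) :: st) r x else 0
    | some .equal => ∑ r, if (q, b, r) ∈ A.shift then
        A.wtShift q b r * totalWeight A ((h b, p) :: st) r x else 0
    | some .takes => ∑ r, if (q, p, r) ∈ A.pop then
        A.wtPop q p r * totalWeight A st r (b :: x) else 0
    | none => 0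
termination_by st _ x => 2 * x.length + st.length

variable (A : WOPA (M.comap h) K Q)

open scoped Classical in
theorem totalWeight_nil (q : Q) : A.totalWeight [] q [] = if q ∈ A.final then 1 else 0 := by
  rw [totalWeight]

open scoped Classical in
theorem totalWeight_push {st : List (α × Q)} {q : Q} {b : β} {x : List β}
    (hM : M.prec (topSymbol st) (some (h b)) = some Prec.yields) :
    A.totalWeight st q (b :: x) = ∑ r, if (q, b, r) ∈ A.push then
      A.wtPush q b r * A.totalWeight ((h b, q) :: st) r x else 0 := by
  rcases st with _ | ⟨⟨a, p⟩, st⟩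
  · rw [totalWeight]
  · have hM' : M.entry a (h b) = some Prec.yields := hM
    rw [totalWeight, hM']

open scoped Classical in
theorem totalWeight_shift {st : List (α × Q)} {a : α} {p q : Q} {b : β} {x : List β}
    (hM : M.prec (some a) (some (h b)) = some Prec.equal) :
    A.totalWeight ((a, p) :: st) q (b :: x) = ∑ r, if (q, b, r) ∈ A.shift then
      A.wtShift q b r * A.totalWeight ((h b, p) :: st) r x else 0 := by
  have hM' : M.entry a (h b) = some Prec.equal := hM
  rw [totalWeight, hM']

open scoped Classical in
theorem totalWeight_pop {st : List (α × Q)} {a : α} {p q : Q} {x : List β}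
    (hM : M.prec (some a) (x.head?.map h) = some Prec.takes) :
    A.totalWeight ((a, p) :: st) q x = ∑ r, if (q, p, r) ∈ A.pop then
      A.wtPop q p r * A.totalWeight st r x else 0 := by
  rcases x with _ | ⟨b, x⟩
  · rw [totalWeight]
  · have hM' : M.entry a (h b) = some Prec.takes := hM
    rw [totalWeight, hM']

theorem totalWeight_of_prec_eq_none {st : List (α × Q)} {q : Q} {b : β} {x : List β}
    (hM : M.prec (topSymbol st) (some (h b)) = none) : A.totalWeight st q (b :: x) = 0 := by
  rcases st with _ | ⟨⟨a, p⟩, st⟩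
  · cases hM
  · have hM' : M.entry a (h b) = none := hM
    rw [totalWeight, hM']

/-- The accepting continuations of a run that has reached the configuration `C`. -/
def acceptingTails (C : Config β Q K) : Set (List (Config β Q K)) :=
  {ρ | (C :: ρ).IsChain A.Step ∧ ∃ qF ∈ A.final, ∃ k, (C :: ρ).getLast? = some ⟨[], qF, [], k⟩}

theorem finite_acceptingTails (C : Config β Q K) : (A.acceptingTails C).Finite :=
  (A.finite_setOf_isChain _ C le_rfl).subset fun _ hρ => hρ.1

open scoped Classical in
-- Tails are sorted by their first configuration: `hC` rules out the empty tail, and injectivity of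
-- `D` makes the pieces disjoint.
theorem finsum_acceptingTails (C : Config β Q K) (hC : C.stack ≠ [] ∨ C.input ≠ [])
    (D : Q → Config β Q K) (hD : D.Injective) (T : Q → Prop)
    (hstep : ∀ C', A.Step C C' ↔ ∃ r, T r ∧ C' = D r) :
    ∑ᶠ ρ ∈ A.acceptingTails C, runWeight (C :: ρ) =
      ∑ r, if T r then ∑ᶠ ρ ∈ A.acceptingTails (D r), runWeight (D r :: ρ) else 0 := by
  have hset : A.acceptingTails C =
      ⋃ r ∈ {r | T r}, List.cons (D r) '' A.acceptingTails (D r) := by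
    ext ρ
    rcases ρ with _ | ⟨C', ρ⟩
    · simp only [acceptingTails, Set.mem_ofPred_eq, List.getLast?_singleton, Set.mem_iUnion,
        Set.mem_image, reduceCtorEq, and_false, exists_false, iff_false]
      rintro ⟨-, q, -, k, hk⟩
      cases hk
      simp at hC
    · simp only [acceptingTails, Set.mem_ofPred_eq, List.isChain_cons_cons, hstep,
        List.getLast?_cons_cons, Set.mem_iUnion, Set.mem_image, List.cons.injEq]
      constructor
      · rintro ⟨⟨⟨r, hr, rfl⟩, h1⟩, h2⟩
        exact ⟨r, hr, ρ, ⟨h1, h2⟩, rfl, rfl⟩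
      · rintro ⟨r, hr, _, ⟨h1, h2⟩, rfl, rfl⟩
        exact ⟨⟨⟨r, hr, rfl⟩, h1⟩, h2⟩
  rw [hset, finsum_mem_biUnion _ (Set.toFinite _) fun r _ => (A.finite_acceptingTails _).image _,
    ← Finset.sum_filter, finsum_mem_eq_sum_of_inter_support_eq (t := Finset.univ.filter T) _
      (by ext; simp)]
  · refine Finset.sum_congr rfl fun r _ => ?_
    rw [finsum_mem_image List.cons_injective.injOn]
    rfl
  · intro r _ r' _ hne
    refine Set.disjoint_left.2 ?_
    rintro _ ⟨ρ, _, rfl⟩ ⟨ρ', _, h⟩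
    simp only [List.cons.injEq] at h
    exact hne (hD h.1.symm)

/-- Moves multiply the accumulated weight on the right, so `k` remains the leftmost factor and
associativity suffices. -/
theorem finsum_acceptingTails_eq (st : List (β × Q)) (x : List β) : ∀ (q : Q) (k : K),
    ∑ᶠ ρ ∈ A.acceptingTails ⟨st, q, x, k⟩, runWeight (⟨st, q, x, k⟩ :: ρ) =
      k * A.totalWeight (st.map (Prod.map h id)) q x := by
  classical
  induction st, x using OPM.move_induction (M.comap h) (id : β → β) with
  | nil =>
    intro q k
    have hset : A.acceptingTails ⟨[], q, [], k⟩ = if q ∈ A.final then {[]} else ∅ := by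
      ext ρ
      rcases ρ with _ | ⟨C', ρ⟩
      · by_cases hq : q ∈ A.final <;> simp [acceptingTails, hq]
      · have : (C' :: ρ) ∉ A.acceptingTails ⟨[], q, [], k⟩ := by
          rintro ⟨hch, -⟩
          cases (List.isChain_cons_cons.1 hch).1
        by_cases hq : q ∈ A.final <;> simp [this, hq]
    rw [hset, List.map_nil, totalWeight]
    by_cases hq : q ∈ A.final <;> simp [hq, runWeight]
  | push st b x hM ih =>
    intro q k
    rw [A.finsum_acceptingTails _ (Or.inr (by simp))
      (fun r => ⟨(b, q) :: st, r, x, k * A.wtPush q b r⟩) (fun r r' h => (Config.mk.inj h).2.1)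
      (fun r => (q, b, r) ∈ A.push), totalWeight_push, Finset.mul_sum]
    · refine Finset.sum_congr rfl fun r _ => ?_
      split_ifs
      · exact (ih q r _).trans (mul_assoc _ _ _)
      · simp
    · rw [OPM.prec_comap] at hM
      rw [topSymbol_map]
      exact hM
    · intro C'
      constructor
      · intro H
        cases H with
        | push _ _ r _ _ _ _ hA => exact ⟨r, hA, rfl⟩
        | shift _ _ _ _ _ _ _ _ hM' => simp [topSymbol, hM'] at hM
        | pop _ _ _ _ _ _ _ hM' => simp [topSymbol] at hM hM'; simp [hM'] at hM
      · rintro ⟨r, hA, rfl⟩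
        exact .push _ _ _ _ _ _ hM hA
  | shift st a p b x hM ih =>
    intro q k
    rw [A.finsum_acceptingTails _ (Or.inr (by simp))
      (fun r => ⟨(b, p) :: st, r, x, k * A.wtShift q b r⟩) (fun r r' h => (Config.mk.inj h).2.1)
      (fun r => (q, b, r) ∈ A.shift), List.map_cons, Prod.map_apply, A.totalWeight_shift (h := h) (a := h a) (b := b) hM,
      Finset.mul_sum]
    · refine Finset.sum_congr rfl fun r _ => ?_
      split_ifs
      · exact (ih r _).trans (mul_assoc _ _ _)
      · simp
    · intro C'
      constructor
      · intro H
        cases H with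
        | push _ _ _ _ _ _ hM' => simp [topSymbol] at hM hM'; simp [hM'] at hM
        | shift _ _ _ _ r _ _ _ _ hA => exact ⟨r, hA, rfl⟩
        | pop _ _ _ _ _ _ _ hM' => simp at hM hM'; simp [hM'] at hM
      · rintro ⟨r, hA, rfl⟩
        exact .shift _ _ _ _ _ _ _ _ hM hA
  | pop st a p x hM ih =>
    intro q k
    rw [A.finsum_acceptingTails _ (Or.inl (by simp))
      (fun r => ⟨st, r, x, k * A.wtPop q p r⟩) (fun r r' h => (Config.mk.inj h).2.1)
      (fun r => (q, p, r) ∈ A.pop), List.map_cons, Prod.map_apply, id_eq, totalWeight_pop,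
      Finset.mul_sum]
    · refine Finset.sum_congr rfl fun r _ => ?_
      split_ifs
      · exact (ih r _).trans (mul_assoc _ _ _)
      · simp
    · rw [OPM.prec_comap, Option.map_id] at hM
      exact hM
    · rw [Option.map_id] at hM
      intro C'
      constructor
      · intro H
        cases H with
        | push _ _ _ _ _ _ hM' => simp [topSymbol] at hM hM'; simp [hM'] at hM
        | shift _ _ _ _ _ _ _ _ hM' => simp at hM hM'; simp [hM'] at hM
        | pop _ _ _ _ r _ _ _ hA => exact ⟨r, hA, rfl⟩
      · rintro ⟨r, hA, rfl⟩
        exact .pop _ _ _ _ _ _ _ hM hA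
  | stuck st b x hM =>
    intro q k
    have hset : A.acceptingTails ⟨st, q, b :: x, k⟩ = ∅ := by
      refine Set.eq_empty_of_forall_notMem ?_
      rintro (_ | ⟨C', ρ⟩) ⟨hch, q, -, k, hk⟩
      · simp at hk
      · cases (List.isChain_cons_cons.1 hch).1 with
        | push _ _ _ _ _ _ hM' => simp [hM'] at hM
        | shift _ _ _ _ _ _ _ _ hM' => simp [topSymbol, hM'] at hM
        | pop _ _ _ _ _ _ _ hM' => simp [topSymbol] at hM hM'; simp [hM'] at hM
    rw [hset, finsum_mem_empty, totalWeight_of_prec_eq_none, mul_zero]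
    rw [OPM.prec_comap] at hM
    rw [topSymbol_map]
    exact hM

open scoped Classical in
theorem behavior_eq_sum_totalWeight (w : OPWord (M.comap h)) :
    A.behavior w = ∑ q, if q ∈ A.init then A.totalWeight [] q w.1 else 0 := by
  have hset : A.acceptingRuns w.1 = ⋃ q ∈ A.init,
      List.cons ⟨[], q, w.1, 1⟩ '' A.acceptingTails ⟨[], q, w.1, 1⟩ := by
    ext ρ
    rcases ρ with _ | ⟨C, ρ⟩
    · simp [acceptingRuns]
    · simp only [acceptingRuns, acceptingTails, Set.mem_ofPred_eq, List.head?_cons,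
        Option.some.injEq, Set.mem_iUnion, Set.mem_image, List.cons.injEq]
      constructor
      · rintro ⟨h1, ⟨q, hq, rfl⟩, h2⟩
        exact ⟨q, hq, ρ, ⟨h1, h2⟩, rfl, rfl⟩
      · rintro ⟨q, hq, _, ⟨h1, h2⟩, rfl, rfl⟩
        exact ⟨h1, ⟨q, hq, rfl⟩, h2⟩
  rw [behavior, hset, finsum_mem_biUnion _ (Set.toFinite _) fun r _ =>
      (A.finite_acceptingTails _).image _, ← Finset.sum_filter,
    finsum_mem_eq_sum_of_inter_support_eq (t := Finset.univ.filter (· ∈ A.init)) _ (by ext; simp)]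
  · refine Finset.sum_congr rfl fun q _ => ?_
    rw [finsum_mem_image List.cons_injective.injOn, finsum_acceptingTails_eq, one_mul, List.map_nil]
  · intro r _ r' _ hne
    refine Set.disjoint_left.2 ?_
    rintro _ ⟨ρ, _, rfl⟩ ⟨ρ', _, h⟩
    simp only [List.cons.injEq, Config.mk.injEq] at h
    exact hne h.1.2.1.symm

end WOPA

/-! ### From restricted automata to projections -/

section Forward

variable {α γ K Q : Type*} {M : OPM α}

/-- The projection of the alphabet `γ × Q × Q × Option Q` of annotated letters, where `γ` is a copy
of `α`. A letter `(b, q, r, some s)` stands for a push of `b` from `q` to `r` such that the pushed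
symbol is popped into state `s`, and `(b, q, r, none)` for a shift of `b` from `q` to `r`. -/
def letterMap (Q : Type*) (e : γ ≃ α) (b : γ × Q × Q × Option Q) : α :=
  e b.1

/-- Forgets the promised state of a stack entry. -/
def forgetPromise (c : α × Q × Q) : α × Q :=
  (c.1, c.2.1)

namespace WOPA

/-- The automaton that checks that a word of annotated letters describes an accepting run of `A`.
The second component of a state guesses the annotation of the next pushed letter. -/
def runChecker (A : WOPA M K Q) (e : γ ≃ α) : OPA (M.comap (letterMap Q e)) (Q × Q) where
  init := {s | s.1 ∈ A.init}
  final := {s | s.1 ∈ A.final}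
  push := {t | t.2.1.2 = (t.1.1, t.2.2.1, some t.1.2) ∧ (t.1.1, e t.2.1.1, t.2.2.1) ∈ A.push}
  shift := {t | t.2.1.2 = (t.1.1, t.2.2.1, none) ∧ (t.1.1, e t.2.1.1, t.2.2.1) ∈ A.shift}
  pop := {t | t.2.2.1 = t.2.1.2 ∧ (t.1.1, t.2.1.1, t.2.2.1) ∈ A.pop}

/-- The automaton with one state that reads off the weights of annotated letters. -/
def letterWeight [Semiring K] (A : WOPA M K Q) (e : γ ≃ α) : WOPA (M.comap (letterMap Q e)) K Unit where
  init := Set.univ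
  final := Set.univ
  push := Set.univ
  shift := Set.univ
  pop := Set.univ
  wtPush _ b _ := A.wtPush b.2.1 (e b.1) b.2.2.1
  wtShift _ b _ := A.wtShift b.2.1 (e b.1) b.2.2.1
  wtPop _ _ _ := 1

end WOPA

open scoped Classical in
-- Only the target and the promise of a push letter are free once its image and source are fixed.
theorem sum_pushLetter [Semiring K] [Fintype γ] [Fintype Q] (e : γ ≃ α) (b : α) (q : Q)
    (F : γ × Q × Q × Option Q → K)
    (hF : ∀ q' r o, F (e.symm b, q', r, o) ≠ 0 → q' = q ∧ o ≠ none) :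
    ∑ c with letterMap Q e c = b, F c = ∑ r, ∑ s, F (e.symm b, q, r, some s) := by
  rw [Finset.sum_filter, Fintype.sum_prod_type, Fintype.sum_eq_single (e.symm b),
    Fintype.sum_prod_type, Fintype.sum_eq_single q, Fintype.sum_prod_type]
  · refine Finset.sum_congr rfl fun r _ => ?_
    have h0 : F (e.symm b, q, r, none) = 0 := by
      by_contra h
      exact (hF _ _ _ h).2 rfl
    simp [Fintype.sum_option, letterMap, h0]
  · intro q' hq'
    refine Finset.sum_eq_zero fun ⟨r, o⟩ _ => ?_
    have h0 : F (e.symm b, q', r, o) = 0 := by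
      by_contra h
      exact hq' (hF _ _ _ h).1
    simp [h0]
  · intro c hc
    have hc' : e c ≠ b := fun h => hc (by simp [← h])
    simp [letterMap, hc']

open scoped Classical in
theorem sum_shiftLetter [Semiring K] [Fintype γ] [Fintype Q] (e : γ ≃ α) (b : α) (q : Q)
    (F : γ × Q × Q × Option Q → K)
    (hF : ∀ q' r o, F (e.symm b, q', r, o) ≠ 0 → q' = q ∧ o = none) :
    ∑ c with letterMap Q e c = b, F c = ∑ r, F (e.symm b, q, r, none) := by
  rw [Finset.sum_filter, Fintype.sum_prod_type, Fintype.sum_eq_single (e.symm b),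
    Fintype.sum_prod_type, Fintype.sum_eq_single q, Fintype.sum_prod_type]
  · refine Finset.sum_congr rfl fun r _ => ?_
    have h0 : ∀ s, F (e.symm b, q, r, some s) = 0 := by
      intro s
      by_contra h
      exact Option.some_ne_none _ (hF _ _ _ h).2
    simp [Fintype.sum_option, letterMap, h0]
  · intro q' hq'
    refine Finset.sum_eq_zero fun ⟨r, o⟩ _ => ?_
    have h0 : F (e.symm b, q', r, o) = 0 := by
      by_contra h
      exact hq' (hF _ _ _ h).1
    simp [h0]
  · intro c hc
    have hc' : e c ≠ b := fun h => hc (by simp [← h])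
    simp [letterMap, hc']

theorem liftSum_forgetPromise_cons [Semiring K] [Fintype α] [Fintype Q] (a : α) (p : Q) (st : List (α × Q))
    (f : List (α × Q × Q) → K) : liftSum forgetPromise ((a, p) :: st) f =
      ∑ s, liftSum forgetPromise st fun l => f ((a, p, s) :: l) := by
  classical
  rw [liftSum, Finset.sum_filter, Fintype.sum_prod_type, Fintype.sum_eq_single a,
    Fintype.sum_prod_type, Fintype.sum_eq_single p]
  · simp [forgetPromise]
  · intro p' hp'
    simp [forgetPromise, hp']
  · intro a' ha'
    simp [forgetPromise, ha']

theorem topSymbol_of_map_forgetPromise {cst : List (α × Q × Q)} {st : List (α × Q)}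
    (h : cst.map forgetPromise = st) : topSymbol cst = topSymbol st := by
  subst h
  cases cst <;> rfl

namespace WOPA

section Accepts

variable {A : WOPA M K Q} {e : γ ≃ α} {cst : List (α × Q × Q)}

/-- A push stores the state held before the letter is read, so the promise must already be guessed
there. Quantifying over the guess `g` hides this: the letter then determines it. -/
theorem runChecker_accepts_push_iff {q q' r : Q} {b : γ} {o : Option Q}
    {x : List (γ × Q × Q × Option Q)}
    (hM : M.prec (topSymbol cst) (some (e b)) = some Prec.yields) :
    (∃ g, (A.runChecker e).Accepts cst (q, g) ((b, q', r, o) :: x)) ↔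
      q' = q ∧ (q, e b, r) ∈ A.push ∧
        ∃ s, o = some s ∧ ∃ g, (A.runChecker e).Accepts ((e b, q, s) :: cst) (r, g) x := by
  have hM' : M.prec (topSymbol cst) (some (letterMap Q e (b, q', r, o))) = some Prec.yields := hM
  constructor
  · rintro ⟨s, H⟩
    obtain ⟨⟨r', g⟩, ⟨h1, h2⟩, h3⟩ := (OPA.accepts_push_iff hM').1 H
    simp only [Prod.mk.injEq] at h1 h2
    obtain ⟨rfl, rfl, rfl⟩ := h1
    exact ⟨rfl, h2, s, rfl, g, h3⟩
  · rintro ⟨rfl, h2, s, rfl, g, h3⟩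
    exact ⟨s, (OPA.accepts_push_iff hM').2 ⟨(r, g), ⟨rfl, h2⟩, h3⟩⟩

theorem runChecker_accepts_shift_iff {a : α} {p : Q × Q} {q q' r : Q} {b : γ} {o : Option Q}
    {x : List (γ × Q × Q × Option Q)} (hM : M.prec (some a) (some (e b)) = some Prec.equal) :
    (∃ g, (A.runChecker e).Accepts ((a, p) :: cst) (q, g) ((b, q', r, o) :: x)) ↔
      q' = q ∧ (q, e b, r) ∈ A.shift ∧
        o = none ∧ ∃ g, (A.runChecker e).Accepts ((e b, p) :: cst) (r, g) x := by
  have hM' : M.prec (some a) (some (letterMap Q e (b, q', r, o))) = some Prec.equal := hM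
  constructor
  · rintro ⟨s, H⟩
    obtain ⟨⟨r', g⟩, ⟨h1, h2⟩, h3⟩ := (OPA.accepts_shift_iff hM').1 H
    simp only [Prod.mk.injEq] at h1 h2
    obtain ⟨rfl, rfl, rfl⟩ := h1
    exact ⟨rfl, h2, rfl, g, h3⟩
  -- A shift ignores the guess, so any value serves.
  · rintro ⟨rfl, h2, rfl, g, h3⟩
    exact ⟨q', (OPA.accepts_shift_iff hM').2 ⟨(r, g), ⟨rfl, h2⟩, h3⟩⟩

theorem runChecker_accepts_pop_iff {a : α} {p s q : Q} {x : List (γ × Q × Q × Option Q)}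
    (hM : M.prec (some a) (x.head?.map (letterMap Q e)) = some Prec.takes) :
    (∃ g, (A.runChecker e).Accepts ((a, p, s) :: cst) (q, g) x) ↔
      (q, p, s) ∈ A.pop ∧ ∃ g, (A.runChecker e).Accepts cst (s, g) x := by
  constructor
  · rintro ⟨s', H⟩
    obtain ⟨⟨r', g⟩, ⟨h1, h2⟩, h3⟩ := (OPA.accepts_pop_iff hM).1 H
    simp only at h1 h2
    subst h1
    exact ⟨h2, g, h3⟩
  · rintro ⟨h2, g, h3⟩
    exact ⟨s, (OPA.accepts_pop_iff hM).2 ⟨(s, g), ⟨rfl, h2⟩, h3⟩⟩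

end Accepts

variable [Semiring K] [Fintype α] [Fintype γ] [Fintype Q]

open scoped Classical in
-- A continuation of the run amounts to promises for the entries on the stack together with
-- annotations of the remaining letters. `h := id` is harmless, as `M.comap id` is `M` by
-- definition.
theorem totalWeight_eq_liftSum_runChecker (A : WOPA M K Q) (hA : A.Restricted) (e : γ ≃ α)
    (st : List (α × Q)) (v : List α) : ∀ q : Q,
    totalWeight (M := M) (h := id) A st q v = liftSum forgetPromise st fun cst =>
      liftSum (letterMap Q e) v fun w => if ∃ g, (A.runChecker e).Accepts cst (q, g) w then
        (A.letterWeight e).totalWeight (st.map fun c => (c.1, ())) () w else 0 := by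
  induction st, v using OPM.move_induction M (id : α → α) with
  | nil =>
    intro q
    refine (totalWeight_nil (h := id) (M := M) A q).trans ?_
    simp only [liftSum, OPA.accepts_nil_iff, List.map_nil, totalWeight_nil, runChecker,
      letterWeight, Set.mem_univ, if_true, Set.mem_ofPred_eq]
    congr 1
    exact propext ⟨fun hq => ⟨q, hq⟩, fun ⟨_, hq⟩ => hq⟩
  | push st b x hM ih =>
    intro q
    have hB : ∀ (c : γ × Q × Q × Option Q) w, letterMap Q e c = b →
        (A.letterWeight e).totalWeight (st.map fun c => (c.1, ())) () (c :: w) =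
        A.wtPush c.2.1 b c.2.2.1 *
          (A.letterWeight e).totalWeight (((b, q) :: st).map fun c => (c.1, ())) () w := by
      rintro c w rfl
      rw [totalWeight_push]
      · simp [letterWeight, letterMap]
      · rw [← hM]
        cases st <;> rfl
    rw [totalWeight_push (h := id) (M := M) A hM]
    calc
      -- `s` is the promise of the entry just pushed; on the right-hand side it is part of the
      -- letter read.
      _ = ∑ r, ∑ s, liftSum forgetPromise st fun cst => liftSum (letterMap Q e) x fun w =>
          if (q, b, r) ∈ A.push ∧ ∃ g, (A.runChecker e).Accepts ((b, q, s) :: cst) (r, g) w then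
            A.wtPush q b r * (A.letterWeight e).totalWeight
              (((b, q) :: st).map fun c => (c.1, ())) () w else 0 := by
        refine Finset.sum_congr rfl fun r _ => ?_
        rw [show id b = b from rfl]
        by_cases hr : (q, b, r) ∈ A.push
        · rw [if_pos hr]
          erw [ih q r]
          simp only [id_eq, liftSum_forgetPromise_cons, hr, true_and, Finset.mul_sum,
            ← liftSum_mul_left, mul_ite, mul_zero]
        · simp only [hr, if_false, false_and, liftSum_zero, Finset.sum_const_zero]
      _ = _ := by
        simp_rw [← liftSum_sum]
        refine liftSum_congr _ fun cst hcst => ?_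
        rw [← topSymbol_of_map_forgetPromise hcst] at hM
        simp only [liftSum]
        rw [sum_pushLetter e b q]
        · simp_rw [← liftSum_sum]
          refine liftSum_congr _ fun w _ => Finset.sum_congr rfl fun r _ =>
            Finset.sum_congr rfl fun s _ => ?_
          have := runChecker_accepts_push_iff (A := A) (e := e) (cst := cst) (q := q) (q' := q)
            (r := r) (b := e.symm b) (o := some s) (x := w) (by simpa using hM)
          rw [hB _ _ (by simp [letterMap])]
          simp only [this, Equiv.apply_symm_apply, true_and, Option.some.injEq, exists_eq_left']
        · intro q' r o hne
          by_contra hcon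
          refine hne ((liftSum_congr _ fun w _ => ?_).trans (liftSum_zero (letterMap Q e) x))
          rw [if_neg]
          rw [runChecker_accepts_push_iff (by simpa using hM)]
          rintro ⟨rfl, -, s, rfl, -⟩
          exact hcon ⟨rfl, Option.some_ne_none _⟩
  | shift st a p b x hM ih =>
    intro q
    have hB : ∀ (c : γ × Q × Q × Option Q) w, letterMap Q e c = b →
        (A.letterWeight e).totalWeight (((a, p) :: st).map fun c => (c.1, ())) () (c :: w) =
        A.wtShift c.2.1 b c.2.2.1 *
          (A.letterWeight e).totalWeight (((b, p) :: st).map fun c => (c.1, ())) () w := by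
      rintro c w rfl
      rw [List.map_cons, totalWeight_shift]
      · simp [letterWeight, letterMap]
      · exact hM
    rw [totalWeight_shift (h := id) (M := M) A hM]
    calc
      _ = ∑ s, ∑ r, liftSum forgetPromise st fun cst => liftSum (letterMap Q e) x fun w =>
          if (q, b, r) ∈ A.shift ∧ ∃ g, (A.runChecker e).Accepts ((b, p, s) :: cst) (r, g) w then
            A.wtShift q b r * (A.letterWeight e).totalWeight
              (((b, p) :: st).map fun c => (c.1, ())) () w else 0 := by
        rw [Finset.sum_comm]
        refine Finset.sum_congr rfl fun r _ => ?_
        rw [show id b = b from rfl]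
        by_cases hr : (q, b, r) ∈ A.shift
        · rw [if_pos hr]
          erw [ih r]
          simp only [id_eq, liftSum_forgetPromise_cons, hr, true_and, Finset.mul_sum,
            ← liftSum_mul_left, mul_ite, mul_zero]
        · simp only [hr, if_false, false_and, liftSum_zero, Finset.sum_const_zero]
      _ = _ := by
        -- A shift keeps the promise of the top entry, so `s` remains a choice on the stack.
        rw [liftSum_forgetPromise_cons]
        refine Finset.sum_congr rfl fun s _ => ?_
        simp_rw [← liftSum_sum]
        refine liftSum_congr _ fun cst hcst => ?_
        simp only [liftSum]
        rw [sum_shiftLetter e b q]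
        · simp_rw [← liftSum_sum]
          refine liftSum_congr _ fun w _ => Finset.sum_congr rfl fun r _ => ?_
          have := runChecker_accepts_shift_iff (A := A) (e := e) (cst := cst) (q := q) (q' := q)
            (r := r) (a := a) (p := (p, s)) (b := e.symm b) (o := none) (x := w)
            (by simpa using hM)
          rw [hB _ _ (by simp [letterMap])]
          simp only [this, Equiv.apply_symm_apply, true_and]
        · intro q' r o hne
          by_contra hcon
          refine hne ((liftSum_congr _ fun w _ => ?_).trans (liftSum_zero (letterMap Q e) x))
          rw [if_neg]
          rw [runChecker_accepts_shift_iff (by simpa using hM)]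
          rintro ⟨rfl, -, rfl, -⟩
          exact hcon ⟨rfl, rfl⟩
  | pop st a p x hM ih =>
    intro q
    rw [totalWeight_pop (h := id) (M := M) A hM, liftSum_forgetPromise_cons]
    -- The target of the pop is matched with the promise of the popped entry.
    refine Finset.sum_congr rfl fun r _ => ?_
    rw [ih r]
    have hiff : ∀ cst w, w.map (letterMap Q e) = x →
        ((∃ g, (A.runChecker e).Accepts ((a, p, r) :: cst) (q, g) w) ↔
          (q, p, r) ∈ A.pop ∧ ∃ g, (A.runChecker e).Accepts cst (r, g) w) := by
      rintro cst w rfl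
      exact runChecker_accepts_pop_iff (by simpa using hM)
    have hB : ∀ w, w.map (letterMap Q e) = x →
        (A.letterWeight e).totalWeight (((a, p) :: st).map fun c => (c.1, ())) () w =
          (A.letterWeight e).totalWeight (st.map fun c => (c.1, ())) () w := by
      rintro w rfl
      rw [List.map_cons, totalWeight_pop]
      · simp [letterWeight]
      · simpa using hM
    by_cases hr : (q, p, r) ∈ A.pop
    · rw [if_pos hr, hA q p r hr, one_mul]
      refine liftSum_congr _ fun cst _ => liftSum_congr _ fun w hw => ?_
      simp only [hiff cst w hw, hB w hw, hr, true_and]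
    · rw [if_neg hr]
      refine (liftSum_zero forgetPromise st).symm.trans (liftSum_congr _ fun cst _ =>
        (liftSum_zero (letterMap Q e) x).symm.trans (liftSum_congr _ fun w hw => ?_))
      simp only [hiff cst w hw, hr, false_and, if_false]
  | stuck st b x hM =>
    intro q
    rw [totalWeight_of_prec_eq_none (h := id) (M := M) A hM]
    refine (liftSum_zero forgetPromise st).symm.trans (liftSum_congr _ fun cst hcst =>
      (liftSum_zero (letterMap Q e) (b :: x)).symm.trans (liftSum_congr _ fun w hw => ?_))
    rw [← topSymbol_of_map_forgetPromise hcst] at hM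
    obtain ⟨c, w, rfl, rfl, rfl⟩ := List.map_eq_cons_iff.1 hw
    rw [if_neg]
    rintro ⟨g, H⟩
    exact OPA.not_accepts_of_prec_eq_none (h := letterMap Q e) hM H

end WOPA

open WOPA in
theorem mem_nivatClass_of_isStrictlyRegular [Semiring K] [Finite α] {S : OPSeries M K}
    (hS : IsStrictlyRegular S) : S ∈ NivatClass M K := by
  classical
  obtain ⟨Q, _, A, hA, rfl⟩ := hS
  have := Fintype.ofFinite Q
  have := Fintype.ofFinite α
  -- `NivatClass` asks for an alphabet in `Type`, while `α` may live in a higher universe.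
  let e : Fin (Fintype.card α) ≃ α := (Fintype.equivFin α).symm
  refine ⟨Fin (Fintype.card α) × Q × Q × Option Q, inferInstance, letterMap Q e, Unit, by simp,
    A.letterWeight e, (A.runChecker e).language, fun _ _ _ _ => rfl,
    ⟨Q × Q, inferInstance, A.runChecker e, rfl⟩, ?_⟩
  funext v
  rw [imageSeries_eq_liftSum (letterMap Q e) _ (fun w =>
    if ∃ q ∈ (A.runChecker e).init, (A.runChecker e).Accepts [] q w then
      (A.letterWeight e).totalWeight [] () w else 0)]
  · refine (behavior_eq_sum_totalWeight (h := id) (M := M) A v).trans ?_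
    simp only [totalWeight_eq_liftSum_runChecker A hA e [] v.1, liftSum, List.map_nil]
    calc
      _ = ∑ q, liftSum (letterMap Q e) v.1 fun w =>
          if q ∈ A.init ∧ ∃ g, (A.runChecker e).Accepts [] (q, g) w then
            (A.letterWeight e).totalWeight [] () w else 0 := by
        refine Finset.sum_congr rfl fun q _ => ?_
        by_cases hq : q ∈ A.init
        · simp only [hq, if_true, true_and]
        · simp only [hq, if_false, false_and, liftSum_zero]
      _ = _ := by
        rw [← liftSum_sum]
        refine liftSum_congr _ fun w hw => ?_
        -- Acceptance by the checker does not count initial states; the source on the first letter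
        -- singles one out, which needs a non-empty word.
        rcases w with _ | ⟨⟨b, q, r, o⟩, w⟩
        · exact absurd hw.symm v.2.1
        · have huniq : ∀ q' g, (A.runChecker e).Accepts [] (q', g) ((b, q, r, o) :: w) →
              q' = q := fun q' g H =>
            ((runChecker_accepts_push_iff rfl).1 ⟨g, H⟩).1.symm
          rw [Fintype.sum_eq_single q]
          · congr 1
            refine propext ⟨?_, ?_⟩
            · rintro ⟨h1, g, h2⟩
              exact ⟨(q, g), h1, h2⟩
            · rintro ⟨⟨q', g⟩, h1, h2⟩
              obtain rfl := huniq _ _ h2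
              exact ⟨h1, g, h2⟩
          · rintro q' hq'
            rw [if_neg]
            rintro ⟨-, g, h⟩
            exact hq' (huniq _ _ h)
  · intro w
    rw [Set.indicator_apply]
    simp only [OPA.mem_language_iff, behavior_eq_sum_totalWeight]
    simp [letterWeight]

end Forward

/-! ### From projections to restricted automata -/

section Backward

variable {α β P R K : Type*} {M : OPM α} {h : β → α}

namespace OPA

/-- The successor under a push in the subset construction. The elements of a subset are the pairs
of a possible current state and a possible state of the topmost stack entry. -/
def subsetPush (D : OPA (M.comap h) P) (b : β) (S : Set (P × P)) : Set (P × P) :=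
  {t | (∃ q₀, (t.2, q₀) ∈ S) ∧ (t.2, b, t.1) ∈ D.push}

/-- The successor under a shift in the subset construction. -/
def subsetShift (D : OPA (M.comap h) P) (b : β) (S : Set (P × P)) : Set (P × P) :=
  {t | ∃ q, (q, t.2) ∈ S ∧ (q, b, t.1) ∈ D.shift}

/-- The successor under a pop of `T` in the subset construction. -/
def subsetPop (D : OPA (M.comap h) P) (S T : Set (P × P)) : Set (P × P) :=
  {t | ∃ q p, (q, p) ∈ S ∧ (p, t.2) ∈ T ∧ (q, p, t.1) ∈ D.pop}

/-- `Represents S Ts q ps`: state `q` with stack `ps` is one of the possibilities that are encoded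
by the subset `S` with the stack `Ts` of subsets. -/
def Represents : Set (P × P) → List (α × Set (P × P)) → P → List (α × P) → Prop
  | S, [], q, [] => ∃ z, (q, z) ∈ S
  | S, (a, T) :: Ts, q, (a', p) :: ps => a = a' ∧ (q, p) ∈ S ∧ Represents T Ts p ps
  | _, _, _, _ => False

theorem Represents.exists_mem {S : Set (P × P)} {Ts : List (α × Set (P × P))} {q : P}
    {ps : List (α × P)} (H : Represents S Ts q ps) : ∃ z, (q, z) ∈ S := by
  match Ts, ps, H with
  | [], [], H => exact H
  | (_, _) :: _, (_, p) :: _, H => exact ⟨p, H.2.1⟩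

theorem Represents.topSymbol_eq {S : Set (P × P)} {Ts : List (α × Set (P × P))} {q : P}
    {ps : List (α × P)} (H : Represents S Ts q ps) : topSymbol ps = topSymbol Ts := by
  match Ts, ps, H with
  | [], [], _ => rfl
  | (_, _) :: _, (_, _) :: _, H => exact congrArg some H.1.symm

theorem represents_cons_iff {S T : Set (P × P)} {Ts : List (α × Set (P × P))} {a : α} {q : P}
    {ps : List (α × P)} : Represents S ((a, T) :: Ts) q ps ↔
      ∃ p ps', ps = (a, p) :: ps' ∧ (q, p) ∈ S ∧ Represents T Ts p ps' := by
  constructor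
  · intro H
    match ps, H with
    | (_, p) :: ps, ⟨rfl, h1, h2⟩ => exact ⟨p, ps, rfl, h1, h2⟩
  · rintro ⟨p, ps', rfl, h1, h2⟩
    exact ⟨rfl, h1, h2⟩

/-- The popped state `p` links a pair of `S` to a pair of `T`. The states below depend on the
current state only through `p`, so pairs record enough. -/
theorem represents_subsetPop_iff {D : OPA (M.comap h) P} {S T : Set (P × P)}
    {Ts : List (α × Set (P × P))} {r : P} {ps : List (α × P)} :
    Represents (D.subsetPop S T) Ts r ps ↔
      ∃ q p, (q, p) ∈ S ∧ (q, p, r) ∈ D.pop ∧ Represents T Ts p ps := by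
  match Ts, ps with
  | [], [] =>
    constructor
    · rintro ⟨z, q, p, h1, h2, h3⟩
      exact ⟨q, p, h1, h3, z, h2⟩
    · rintro ⟨q, p, h1, h3, z, h2⟩
      exact ⟨z, q, p, h1, h2, h3⟩
  | (_, _) :: _, (_, _) :: _ =>
    constructor
    · rintro ⟨h0, ⟨q, p, h1, h2, h3⟩, h4⟩
      exact ⟨q, p, h1, h3, h0, h2, h4⟩
    · rintro ⟨q, p, h1, h3, h0, h2, h4⟩
      exact ⟨h0, ⟨q, p, h1, h2, h3⟩, h4⟩
  | [], (_, _) :: _ => simp [Represents]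
  | (_, _) :: _, [] => simp [Represents]

/-- Acceptance from one of the configurations that a configuration of subsets encodes. -/
def SubsetAccepts (D : OPA (M.comap h) P) (Ts : List (α × Set (P × P))) (S : Set (P × P))
    (w : List β) : Prop :=
  ∃ q ps, Represents S Ts q ps ∧ D.Accepts ps q w

variable {D : OPA (M.comap h) P} {Ts : List (α × Set (P × P))} {S T : Set (P × P)}

theorem subsetAccepts_push_iff {b : β} {x : List β}
    (hM : M.prec (topSymbol Ts) (some (h b)) = some Prec.yields) :
    D.SubsetAccepts Ts S (b :: x) ↔ D.SubsetAccepts ((h b, S) :: Ts) (D.subsetPush b S) x := by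
  constructor
  · rintro ⟨q, ps, h1, h2⟩
    rw [accepts_push_iff (by rwa [h1.topSymbol_eq])] at h2
    obtain ⟨r, hr, h2⟩ := h2
    exact ⟨r, (h b, q) :: ps, ⟨rfl, ⟨h1.exists_mem, hr⟩, h1⟩, h2⟩
  · rintro ⟨r, ps, h1, h2⟩
    obtain ⟨q, ps, rfl, ⟨-, hr⟩, h1⟩ := represents_cons_iff.1 h1
    exact ⟨q, ps, h1, (accepts_push_iff (by rwa [h1.topSymbol_eq])).2 ⟨r, hr, h2⟩⟩

theorem subsetAccepts_shift_iff {a : α} {b : β} {x : List β}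
    (hM : M.prec (some a) (some (h b)) = some Prec.equal) :
    D.SubsetAccepts ((a, T) :: Ts) S (b :: x) ↔
      D.SubsetAccepts ((h b, T) :: Ts) (D.subsetShift b S) x := by
  constructor
  · rintro ⟨q, ps, h1, h2⟩
    obtain ⟨p, ps, rfl, hS, h1⟩ := represents_cons_iff.1 h1
    obtain ⟨r, hr, h2⟩ := (accepts_shift_iff hM).1 h2
    exact ⟨r, (h b, p) :: ps, ⟨rfl, ⟨q, hS, hr⟩, h1⟩, h2⟩
  · rintro ⟨r, ps, h1, h2⟩
    obtain ⟨p, ps, rfl, ⟨q, hS, hr⟩, h1⟩ := represents_cons_iff.1 h1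
    exact ⟨q, (a, p) :: ps, ⟨rfl, hS, h1⟩, (accepts_shift_iff hM).2 ⟨r, hr, h2⟩⟩

theorem subsetAccepts_pop_iff {a : α} {x : List β}
    (hM : M.prec (some a) (x.head?.map h) = some Prec.takes) :
    D.SubsetAccepts ((a, T) :: Ts) S x ↔ D.SubsetAccepts Ts (D.subsetPop S T) x := by
  constructor
  · rintro ⟨q, ps, h1, h2⟩
    obtain ⟨p, ps, rfl, hS, h1⟩ := represents_cons_iff.1 h1
    obtain ⟨r, hr, h2⟩ := (accepts_pop_iff hM).1 h2
    exact ⟨r, ps, represents_subsetPop_iff.2 ⟨q, p, hS, hr, h1⟩, h2⟩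
  · rintro ⟨r, ps, h1, h2⟩
    obtain ⟨q, p, hS, hr, h1⟩ := represents_subsetPop_iff.1 h1
    exact ⟨q, (a, p) :: ps, ⟨rfl, hS, h1⟩, (accepts_pop_iff hM).2 ⟨r, hr, h2⟩⟩

theorem not_subsetAccepts_of_prec_eq_none {b : β} {x : List β}
    (hM : M.prec (topSymbol Ts) (some (h b)) = none) : ¬ D.SubsetAccepts Ts S (b :: x) := by
  rintro ⟨q, ps, h1, h2⟩
  exact not_accepts_of_prec_eq_none (by rwa [h1.topSymbol_eq]) h2

end OPA

namespace WOPA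

variable [Semiring K] [Fintype β] [Unique R]

open scoped Classical in
/-- The weighted subset automaton whose behavior is the image under `h` of the behavior of the
one-state automaton `B`, restricted to the language of `D`. -/
noncomputable def subsetImage (B : WOPA (M.comap h) K R) (D : OPA (M.comap h) P) :
    WOPA M K (Set (P × P)) where
  init := {S | default ∈ B.init ∧ S = {t | t.1 ∈ D.init}}
  final := {S | default ∈ B.final ∧ ∃ q ∈ D.final, ∃ z, (q, z) ∈ S}
  -- Pushes and shifts that no letter realizes get the empty sum 0 as weight. Pop weights must be 1,
  -- so pops are constrained in the relation itself.
  push := Set.univ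
  shift := Set.univ
  pop := {t | t.2.2 = D.subsetPop t.1 t.2.1 ∧ (default, default, default) ∈ B.pop}
  wtPush S a S' := ∑ b with h b = a ∧ D.subsetPush b S = S',
    if (default, b, default) ∈ B.push then B.wtPush default b default else 0
  wtShift S a S' := ∑ b with h b = a ∧ D.subsetShift b S = S',
    if (default, b, default) ∈ B.shift then B.wtShift default b default else 0
  wtPop _ _ _ := 1

open scoped Classical in
-- This undoes the merging of letters: each has exactly one successor, so summing over successors
-- sums over letters.
theorem sum_fiberwise_mul {ι : Type*} [Fintype ι] (a : α) (next : β → ι) (f : β → K)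
    (g : ι → K) : ∑ i, (∑ b with h b = a ∧ next b = i, f b) * g i =
      ∑ b with h b = a, f b * g (next b) := by
  rw [← Finset.sum_fiberwise (s := Finset.univ.filter fun b => h b = a) (g := next)]
  refine Finset.sum_congr rfl fun i _ => ?_
  rw [Finset.filter_filter, Finset.sum_mul]
  refine Finset.sum_congr rfl fun b hb => ?_
  rw [(Finset.mem_filter.1 hb).2.2]

variable [Fintype P] [Fintype R]

open scoped Classical in
-- For each preimage `w` the sequence of subsets is determined, so `w` is counted once however many
-- accepting runs `D` has on it.
theorem totalWeight_subsetImage (B : WOPA (M.comap h) K R) (hB : B.Restricted)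
    (D : OPA (M.comap h) P) (Ts : List (α × Set (P × P))) (v : List α) : ∀ S : Set (P × P),
    totalWeight (M := M) (h := id) (B.subsetImage D) Ts S v = liftSum h v fun w =>
      if D.SubsetAccepts Ts S w then
        B.totalWeight (Ts.map fun c => (c.1, default)) default w else 0 := by
  induction Ts, v using OPM.move_induction M (id : α → α) with
  | nil =>
    intro S
    have hiff : D.SubsetAccepts [] S [] ↔ ∃ q ∈ D.final, ∃ z, (q, z) ∈ S := by
      constructor
      · rintro ⟨q, ps, h1, h2⟩
        match ps, h1 with
        | [], h1 => exact ⟨q, OPA.accepts_nil_iff.1 h2, h1⟩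
      · rintro ⟨q, hq, h1⟩
        exact ⟨q, [], h1, .nil q hq⟩
    refine (totalWeight_nil (h := id) (M := M) _ S).trans ?_
    simp only [liftSum, hiff, List.map_nil, totalWeight_nil, subsetImage, Set.mem_ofPred_eq]
    by_cases h1 : default ∈ B.final <;> by_cases h2 : ∃ q ∈ D.final, ∃ z, (q, z) ∈ S <;>
      simp only [h1, h2, if_true, if_false, and_self, and_true, and_false]
  | push Ts a x hM ih =>
    intro S
    rw [totalWeight_push (h := id) (M := M) (B.subsetImage D) hM]
    refine (Finset.sum_congr rfl fun S' _ => if_pos (Set.mem_univ _)).trans ?_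
    refine (sum_fiberwise_mul a (fun b => D.subsetPush b S) (fun b =>
      if (default, b, default) ∈ B.push then B.wtPush default b default else 0) _).trans ?_
    rw [liftSum]
    refine Finset.sum_congr rfl fun b hb => ?_
    obtain rfl : h b = a := (Finset.mem_filter.1 hb).2
    rw [id_eq] at hM
    erw [ih S (D.subsetPush b S)]
    rw [← liftSum_mul_left]
    refine liftSum_congr _ fun w _ => ?_
    rw [OPA.subsetAccepts_push_iff hM, totalWeight_push, Fintype.sum_unique]
    · simp only [mul_ite, mul_zero, ite_mul, zero_mul]
      rfl
    · rw [← hM]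
      cases Ts <;> rfl
  | shift Ts a T a' x hM ih =>
    intro S
    rw [totalWeight_shift (h := id) (M := M) (B.subsetImage D) hM]
    refine (Finset.sum_congr rfl fun S' _ => if_pos (Set.mem_univ _)).trans ?_
    refine (sum_fiberwise_mul a' (fun b => D.subsetShift b S) (fun b =>
      if (default, b, default) ∈ B.shift then B.wtShift default b default else 0) _).trans ?_
    rw [liftSum]
    refine Finset.sum_congr rfl fun b hb => ?_
    obtain rfl : h b = a' := (Finset.mem_filter.1 hb).2
    rw [id_eq] at hM
    erw [ih (D.subsetShift b S)]
    rw [← liftSum_mul_left]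
    refine liftSum_congr _ fun w _ => ?_
    rw [OPA.subsetAccepts_shift_iff hM, List.map_cons (a := (a, T)), totalWeight_shift _ hM,
      Fintype.sum_unique]
    simp only [mul_ite, mul_zero, ite_mul, zero_mul]
    rfl
  | pop Ts a T x hM ih =>
    intro S
    rw [totalWeight_pop (h := id) (M := M) (B.subsetImage D) hM, Fintype.sum_eq_single (D.subsetPop S T), ih]
    · by_cases hpop : ((default, default, default) : R × R × R) ∈ B.pop
      · rw [if_pos ⟨rfl, hpop⟩, show (B.subsetImage D).wtPop S T (D.subsetPop S T) = 1 from rfl,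
          one_mul]
        refine liftSum_congr _ fun w hw => ?_
        subst hw
        rw [OPA.subsetAccepts_pop_iff (by simpa using hM), List.map_cons,
          totalWeight_pop _ (by simpa using hM), Fintype.sum_unique, if_pos hpop,
          hB _ _ _ hpop, one_mul]
      · rw [if_neg fun H => hpop H.2]
        refine (liftSum_zero h x).symm.trans (liftSum_congr _ fun w hw => ?_)
        subst hw
        rw [List.map_cons, totalWeight_pop _ (by simpa using hM), Fintype.sum_unique, if_neg hpop,
          ite_self]
    · intro S' hS'
      rw [if_neg fun H => hS' H.1]
  | stuck Ts a x hM =>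
    intro S
    rw [totalWeight_of_prec_eq_none (h := id) (M := M) (B.subsetImage D) hM]
    refine (liftSum_zero h (a :: x)).symm.trans (liftSum_congr _ fun w hw => ?_)
    obtain ⟨b, w, rfl, rfl, rfl⟩ := List.map_eq_cons_iff.1 hw
    rw [if_neg (OPA.not_subsetAccepts_of_prec_eq_none (h := h) hM)]

end WOPA

open WOPA in
theorem isStrictlyRegular_of_mem_nivatClass [Semiring K] {S : OPSeries M K}
    (hS : S ∈ NivatClass M K) : IsStrictlyRegular S := by
  classical
  obtain ⟨β, _, h, R, hR, B, L, hB, ⟨P, _, D, rfl⟩, rfl⟩ := hS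
  obtain ⟨_, _⟩ := Nat.card_eq_one_iff_unique.1 hR
  have := Fintype.ofFinite β
  have := Fintype.ofFinite P
  obtain ⟨_⟩ := nonempty_unique R
  have := Fintype.ofFinite R
  refine ⟨Set (P × P), inferInstance, B.subsetImage D, fun _ _ _ _ => rfl, ?_⟩
  funext v
  have hiff : ∀ w, D.SubsetAccepts [] {t | t.1 ∈ D.init} w ↔ ∃ q ∈ D.init, D.Accepts [] q w := by
    intro w
    constructor
    · rintro ⟨q, ps, h1, h2⟩
      match ps, h1 with
      | [], ⟨z, hz⟩ => exact ⟨q, hz, h2⟩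
    · rintro ⟨q, hq, H⟩
      -- On the empty stack the second component of a pair is a dummy; `q` fills it.
      exact ⟨q, [], ⟨q, hq⟩, H⟩
  rw [imageSeries_eq_liftSum h _ (fun w => if default ∈ B.init then
    if ∃ q ∈ D.init, D.Accepts [] q w then B.totalWeight [] default w else 0 else 0)]
  · refine (behavior_eq_sum_totalWeight (h := id) (M := M) (B.subsetImage D) v).trans ?_
    rw [Fintype.sum_eq_single {t | t.1 ∈ D.init}, totalWeight_subsetImage B hB]
    · simp only [hiff, List.map_nil]
      by_cases hi : default ∈ B.init
      · rw [if_pos ⟨hi, rfl⟩]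
        simp only [hi, if_true]
      · rw [if_neg fun H => hi H.1]
        simp only [hi, if_false, liftSum_zero]
    · intro S' hS'
      rw [if_neg fun H => hS' H.2]
  · intro w
    rw [Set.indicator_apply]
    simp only [OPA.mem_language_iff, behavior_eq_sum_totalWeight, Fintype.sum_unique]
    split_ifs <;> rfl

end Backward

theorem mainTheorem2 {α : Type*} [Finite α] (M : OPM α) {K : Type*} [Semiring K]
    (S : OPSeries M K) :
    IsStrictlyRegular S ↔ S ∈ NivatClass M K :=
  ⟨mem_nivatClass_of_isStrictlyRegular, isStrictlyRegular_of_mem_nivatClass⟩
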